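/- Let $D$ be a unique factorization domain with quotient field $K$, and let $\operatorname{Int}(D)=\{f\in K[X] : f(D)\subseteq D\}$ be the ring of integer-valued polynomials on $D$. Two factorizations of an element into irreducible elements are called essentially the same if they agree up to the order of the factors and multiplication of the factors by units, and essentially different otherwise; the length of a factorization is its number of factors, counted with multiplicity. Then exactly one of the following holds: (1) $\operatorname{Int}(D)=D[X]$ and this ring is a unique factorization domain. (2) $\operatorname{Int}(D)$ has full system of multisets of lengths, i.e., for all positive integers $k$ and all integers $1<n_1\le\dots\le n_k$ there exists $H\in\operatorname{Int}(D)$ which has precisely $k$ essentially different factorizations into irreducible elements of $\operatorname{Int}(D)$, and the lengths of these $k$ factorizations are exactly $n_1,\dots,n_k$. Moreover, (1) holds if and only if the residue field of each height-one prime ideal of $D$ is infinite. -/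

import Mathlib

open Polynomial

/-- The ring `Int(D) = {f ∈ K[X] | f(D) ⊆ D}` of integer-valued polynomials on `D`, where `K` is
the quotient field of `D`. -/
noncomputable def IntPoly (D K : Type*) [CommRing D] [Field K] [Algebra D K] : Subalgebra D K[X] where
  carrier := {f | ∀ a : D, f.eval (algebraMap D K a) ∈ (algebraMap D K).range}
  mul_mem' := fun hf hg a => by
    rw [eval_mul]
    exact mul_mem (hf a) (hg a)
  add_mem' := fun hf hg a => by
    rw [eval_add]
    exact add_mem (hf a) (hg a)
  algebraMap_mem' := fun r a => by
    rw [Polynomial.algebraMap_apply, eval_C]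
    exact ⟨r, rfl⟩

/-- `D[X]` as a subring of `K[X]`: the polynomials all of whose coefficients lie in `D`. -/
noncomputable def polyInFrac (D K : Type*) [CommRing D] [Field K] [Algebra D K] : Subalgebra D K[X] :=
  (Polynomial.mapAlg D K).range

/-- `s` is (the multiset of factors of) a factorization of `r` into irreducible elements of `R`.
Its length is `Multiset.card s`. -/
def IsFactorization {R : Type*} [CommMonoid R] (r : R) (s : Multiset R) : Prop :=
  (∀ a ∈ s, Irreducible a) ∧ s.prod = r

/-- Two factorizations are essentially the same if they agree up to order and associates. -/
def EssentiallySame {R : Type*} [CommMonoid R] (s t : Multiset R) : Prop :=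
  Multiset.Rel Associated s t

/-- `R` has full system of multisets of lengths: for all integers `k ≥ 1` and
`1 < n₁ ≤ … ≤ nₖ` there is an element `H` of `R` which has precisely `k` essentially different
factorizations into irreducible elements of `R`, of lengths exactly `n₁, …, nₖ`. -/
def HasFullSystemOfMultisetsOfLengths (R : Type*) [CommMonoid R] : Prop :=
  ∀ (k : ℕ) (n : Fin k → ℕ), 0 < k → (∀ i, 1 < n i) → Monotone n →
    ∃ (H : R) (F : Fin k → Multiset R),
      (∀ i, IsFactorization H (F i) ∧ Multiset.card (F i) = n i) ∧
      (∀ i j, i ≠ j → ¬ EssentiallySame (F i) (F j)) ∧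
      (∀ s, IsFactorization H s → ∃ i, EssentiallySame s (F i))

/-! If every height-one prime has infinite residue field, a polynomial over `D` with all values
divisible by a prime `p` is zero modulo `p`, so denominators cancel prime by prime: `Int(D) = D[X]`,
which is factorial by Gauss.

Otherwise some prime `p` has `D/(p)` finite, hence a field. Let `E` be the grid `∏ Fin (n i)`, with
integer weights whose zero-sum subsets are exactly the slabs (`exists_weight`). To each `e` belongs
a polynomial, irreducible over `K`, whose values have valuation `|w e|` on the class 0 or 1 modulo
`p`, according to the sign of `w e`, and valuation zero elsewhere. If `T` has weight zero, its
polynomials have equal total valuation `m` on the classes 0 and 1; auxiliary polynomials raise the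
other classes to `m`, and the product divided by `p^m` is integer-valued. By unique factorization in
`K[X]`, its divisors in `Int(D)` are again balanced products, so they correspond to zero-sum
subsets, that is, to slabs (`exists_balanced_of_mul_eq`, `exists_intPoly_of_weight`).

Factorizations of the element of the full grid are then partitions of the grid into hyperplanes.
Disjoint hyperplanes are parallel, so there is one partition per direction `i`, with `n i` parts
(`exists_factorizations_of_slab`). -/

/-! ### Combinatorics of slabs in a finite grid. -/

/-- The union of the hyperplanes `e i = x`, for `x ∈ A`, of a finite grid. -/
def slab {k : ℕ} {n : Fin k → ℕ} (i : Fin k) (A : Finset (Fin (n i))) :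
    Finset (∀ i, Fin (n i)) :=
  Finset.univ.filter (fun e => e i ∈ A)

/-- The subset `T` of a finite grid is determined by a condition on a single coordinate. -/
def IsSlab {k : ℕ} {n : Fin k → ℕ} (T : Finset (∀ i, Fin (n i))) : Prop :=
  ∃ i, ∃ A : Finset (Fin (n i)), T = slab i A

section Slab

variable {k : ℕ} {n : Fin k → ℕ}

@[simp]
theorem mem_slab {i : Fin k} {A : Finset (Fin (n i))} {e : ∀ i, Fin (n i)} :
    e ∈ slab i A ↔ e i ∈ A := by
  simp [slab]

theorem slab_nonempty (hn : ∀ i, 1 < n i) {i : Fin k} {A : Finset (Fin (n i))}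
    (hA : A.Nonempty) : (slab i A).Nonempty := by
  obtain ⟨x, hx⟩ := hA
  exact ⟨Function.update (fun j => ⟨0, (hn j).le⟩) i x, by simpa using hx⟩

/-- A nonempty slab inside a hyperplane is that hyperplane. -/
theorem slab_subset_singleton (hn : ∀ i, 1 < n i) {i j : Fin k} {x : Fin (n i)}
    {A : Finset (Fin (n j))} (hA : A.Nonempty) (h : slab j A ⊆ slab i {x}) :
    slab j A = slab i {x} ∧ j = i := by
  obtain ⟨y, hy⟩ := hA
  have key : ∀ e : ∀ i, Fin (n i), e j ∈ A → e i = x := fun e he => by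
    simpa using h (mem_slab.2 he)
  have hji : j = i := by
    by_contra hne
    have : Nontrivial (Fin (n i)) := Fin.nontrivial_iff_two_le.2 (hn i)
    obtain ⟨x', hx'⟩ := exists_ne x
    refine hx' ?_
    have := key (Function.update (Function.update (fun j => ⟨0, (hn j).le⟩) i x') j y) (by simpa)
    simpa [Function.update_of_ne (Ne.symm hne)] using this
  subst hji
  refine ⟨Finset.Subset.antisymm h fun e he => ?_, rfl⟩
  have h1 : e j = x := by simpa using he
  have h2 := key (Function.update (fun j => ⟨0, (hn j).le⟩) j y) (by simpa)
  rw [mem_slab, h1, ← h2]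
  simpa

/-- A function on a finite product that is unchanged by changes of single coordinates is
constant. -/
theorem eq_of_update_eq {ι : Type*} [Fintype ι] [DecidableEq ι] {α : ι → Type*} {β : Type*}
    (χ : (∀ i, α i) → β) (h : ∀ e i y, χ (Function.update e i y) = χ e) (e e' : ∀ i, α i) :
    χ e = χ e' := by
  have : ∀ s : Finset ι, χ (s.piecewise e e') = χ e' := by
    intro s
    induction s using Finset.induction_on with
    | empty => simp
    | insert a s _ ih => rw [Finset.piecewise_insert, h, ih]
  simpa using this Finset.univ

/-- Exchanging the `i`-th coordinates of two points preserves all hyperplane counts. A set whose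
indicator respects every such exchange cannot depend on two coordinates: once changing coordinate
`i` at one point matters, that coordinate decides membership everywhere. -/
theorem isSlab_of_swap (hk : 0 < k) (T : Finset (∀ i, Fin (n i)))
    (h : ∀ (e e' : ∀ i, Fin (n i)) (i : Fin k),
      (if e ∈ T then (1 : ℚ) else 0) + (if e' ∈ T then 1 else 0) =
        (if Function.update e i (e' i) ∈ T then 1 else 0) +
          (if Function.update e' i (e i) ∈ T then 1 else 0)) :
    IsSlab T := by
  classical
  by_cases hc : ∀ (e : ∀ i, Fin (n i)) i y, (Function.update e i y ∈ T) = (e ∈ T)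
  · by_cases hT : T = ∅
    · exact ⟨⟨0, hk⟩, ∅, by ext; simp [hT]⟩
    · obtain ⟨e, he⟩ := Finset.nonempty_iff_ne_empty.2 hT
      refine ⟨⟨0, hk⟩, Finset.univ, ?_⟩
      ext e'
      simpa using (eq_of_update_eq (fun e => e ∈ T) hc e' e).mpr he
  · push Not at hc
    obtain ⟨e, i, y, hne⟩ := hc
    have hne' : ¬ (Function.update e i y ∈ T ↔ e ∈ T) := fun h => hne (propext h)
    -- Exactly one of `e` and `Function.update e i y` lies in `T`; this difference of one must be
    -- made up by the other pair.
    have h1 : ∀ e' : ∀ i, Fin (n i), e' i = y → (Function.update e' i (e i) ∈ T ↔ e ∈ T) := by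
      intro e' he'
      have := h e e' i
      rw [he'] at this
      by_cases a : e ∈ T <;> by_cases b : Function.update e i y ∈ T <;>
        by_cases c : Function.update e' i (e i) ∈ T <;> by_cases d : e' ∈ T <;>
        simp [a, b, c, d] at this hne' ⊢; norm_num at this
    have h2 : ∀ e' : ∀ i, Fin (n i), Function.update e' i (e i) ∈ T ↔ e ∈ T := by
      intro e'
      simpa using h1 (Function.update e' i y) (by simp)
    refine ⟨i, Finset.univ.filter (fun z => Function.update e i z ∈ T), ?_⟩
    ext e'
    have := h e e' i
    have h3 := h2 e'
    simp only [mem_slab, Finset.mem_filter, Finset.mem_univ, true_and]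
    by_cases a : e ∈ T <;> by_cases b : Function.update e i (e' i) ∈ T <;>
        by_cases c : Function.update e' i (e i) ∈ T <;> by_cases d : e' ∈ T <;>
        simp [a, b, c, d] at this h3 ⊢

/-- There are integral weights on a finite grid for which precisely the slabs have weight zero. -/
theorem exists_weight (hk : 0 < k) :
    ∃ w : (∀ i, Fin (n i)) → ℤ, ∀ T : Finset (∀ i, Fin (n i)), ∑ e ∈ T, w e = 0 ↔ IsSlab T := by
  classical
  let φ : Finset (∀ i, Fin (n i)) → (((∀ i, Fin (n i)) → ℚ) →ₗ[ℚ] ℚ) := fun T => ∑ e ∈ T, LinearMap.proj e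
  have hφ : ∀ T w, φ T w = ∑ e ∈ T, w e := fun T w => by simp [φ]
  let V : Submodule ℚ ((∀ i, Fin (n i)) → ℚ) := ⨅ (i : Fin k) (x : Fin (n i)), LinearMap.ker (φ (slab i {x}))
  have hV : ∀ w, w ∈ V ↔ ∀ i (x : Fin (n i)), ∑ e ∈ slab i {x}, w e = 0 := fun w => by
    simp only [V, Submodule.mem_iInf, LinearMap.mem_ker, hφ]
  let N : Finset (Finset (∀ i, Fin (n i))) := Finset.univ.filter (fun T => ¬ IsSlab T)
  have hN : ∀ T ∈ N, (LinearMap.ker ((φ T).domRestrict V)) ≠ ⊤ := by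
    intro T hT htop
    refine (Finset.mem_filter.1 hT).2 (isSlab_of_swap hk T fun e e' i => ?_)
    -- Each hyperplane contains as many points of the original pair as of the exchanged pair, so
    -- this weight lies in `V`.
    let w : (∀ i, Fin (n i)) → ℚ := Pi.single e 1 + Pi.single e' 1 - Pi.single (Function.update e i (e' i)) 1 -
      Pi.single (Function.update e' i (e i)) 1
    have hs : ∀ S : Finset (∀ i, Fin (n i)), ∑ x ∈ S, w x = (if e ∈ S then (1 : ℚ) else 0) +
        (if e' ∈ S then 1 else 0) - (if Function.update e i (e' i) ∈ S then 1 else 0) -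
          (if Function.update e' i (e i) ∈ S then 1 else 0) := by
      intro S
      simp [w, Finset.sum_add_distrib, Finset.sum_sub_distrib]
    have hw : w ∈ V := by
      rw [hV]
      intro j x
      rw [hs]
      by_cases hij : j = i
      · subst hij; simp only [mem_slab, Function.update_self]; ring
      · simp only [mem_slab, Function.update_of_ne hij]; ring
    have : (⟨w, hw⟩ : V) ∈ LinearMap.ker ((φ T).domRestrict V) := htop ▸ Submodule.mem_top
    rw [LinearMap.mem_ker, LinearMap.domRestrict_apply, hφ, hs] at this
    linarith
  obtain ⟨⟨w, hwV⟩, hw⟩ : ∃ w : V, ∀ T ∈ N, w ∉ LinearMap.ker ((φ T).domRestrict V) := by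
    -- A vector space over the infinite field `ℚ` is not a finite union of proper subspaces.
    by_contra! hcon
    have := Subspace.biUnion_ne_univ_of_top_notMem
      (s := N.image fun T => LinearMap.ker ((φ T).domRestrict V)) (by
        simpa using hN)
    apply this
    ext v
    simpa using hcon v
  obtain ⟨b, hb⟩ := IsLocalization.exist_integer_multiples_of_finset (nonZeroDivisors ℤ)
    (Finset.univ.image w)
  have hb' : ∀ e, ∃ z : ℤ, (z : ℚ) = (b : ℤ) * w e := fun e => by
    obtain ⟨z, hz⟩ := hb (w e) (by simp)
    exact ⟨z, by simpa [Algebra.smul_def] using hz⟩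
  choose z hz using hb'
  have hb0 : ((b : ℤ) : ℚ) ≠ 0 := by
    exact_mod_cast nonZeroDivisors.coe_ne_zero b
  have hsum : ∀ T, ∑ e ∈ T, z e = 0 ↔ ∑ e ∈ T, w e = 0 := fun T => by
    rw [← Int.cast_inj (α := ℚ)]
    push_cast
    simp_rw [hz, ← Finset.mul_sum]
    simp only [mul_eq_zero, hb0, false_or]
  refine ⟨z, fun T => ?_⟩
  rw [hsum]
  constructor
  · intro h
    by_contra hT
    exact hw T (by simp [N, hT]) (by simp [hφ, h])
  · rintro ⟨i, A, rfl⟩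
    have : slab i A = A.biUnion (fun x => slab i {x}) := by ext; simp
    rw [this, Finset.sum_biUnion]
    · exact Finset.sum_eq_zero fun x _ => (hV w).1 hwV i x
    · intro x _ y _ hxy
      refine Finset.disjoint_left.2 fun e he he' => hxy ?_
      simp only [mem_slab, Finset.mem_singleton] at he he'
      rw [← he, he']

/-- Factorizations of an element whose divisors correspond to the slabs of a finite grid. -/
theorem exists_factorizations_of_slab {R : Type*} [CommMonoid R] (hk : 0 < k)
    (hn : ∀ i, 1 < n i) (h : Finset (∀ i, Fin (n i)) → R) (h0 : h ∅ = 1)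
    (hmul : ∀ T T', IsSlab T → IsSlab T' → Disjoint T T' → h (T ∪ T') = h T * h T')
    (hdiv : ∀ T, IsSlab T → ∀ a b, a * b = h T → ∃ T₁ T₂, IsSlab T₁ ∧ IsSlab T₂ ∧
      Disjoint T₁ T₂ ∧ T₁ ∪ T₂ = T ∧ Associated a (h T₁) ∧ Associated b (h T₂))
    (hinj : ∀ T T', IsSlab T → IsSlab T' → Associated (h T) (h T') → T = T') :
    ∃ (H : R) (F : Fin k → Multiset R),
      (∀ i, IsFactorization H (F i) ∧ Multiset.card (F i) = n i) ∧
      (∀ i j, i ≠ j → ¬ EssentiallySame (F i) (F j)) ∧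
      (∀ s, IsFactorization H s → ∃ i, EssentiallySame s (F i)) := by
  have hS : ∀ (i : Fin k) (A : Finset (Fin (n i))), IsSlab (slab i A) := fun i A => ⟨i, A, rfl⟩
  have hS0 : IsSlab (∅ : Finset (∀ i, Fin (n i))) := ⟨⟨0, hk⟩, ∅, by ext; simp⟩
  have hunit : ∀ T, IsSlab T → IsUnit (h T) → T = ∅ := fun T hT hu =>
    hinj _ _ hT hS0 (by rw [h0]; exact associated_one_iff_isUnit.2 hu)
  have hprod : ∀ (i : Fin k) (A : Finset (Fin (n i))),
      ∏ x ∈ A, h (slab i {x}) = h (slab i A) := by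
    intro i A
    induction A using Finset.induction_on with
    | empty =>
      have : slab i (∅ : Finset (Fin (n i))) = ∅ := by ext; simp
      simp [this, h0]
    | insert a A ha ih =>
      rw [Finset.prod_insert ha, ih, ← hmul _ _ (hS _ _) (hS _ _)]
      · congr 1; ext; simp
      · refine Finset.disjoint_left.2 fun e he he' => ha ?_
        simp only [mem_slab, Finset.mem_singleton] at he he'
        rwa [← he]
  have hirr : ∀ (i : Fin k) (x : Fin (n i)), Irreducible (h (slab i {x})) := by
    intro i x
    refine ⟨fun hu => ?_, fun a b hab => ?_⟩
    · exact (slab_nonempty hn (Finset.singleton_nonempty x)).ne_empty (hunit _ (hS _ _) hu)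
    · obtain ⟨T₁, T₂, ⟨j, A, rfl⟩, h2, hd, hu, ha, hb⟩ := hdiv _ (hS i {x}) a b hab.symm
      rcases A.eq_empty_or_nonempty with rfl | hA
      · left
        have : slab j (∅ : Finset (Fin (n j))) = ∅ := by ext; simp
        rw [this, h0] at ha
        exact associated_one_iff_isUnit.1 ha
      · right
        have h1 := (slab_subset_singleton hn hA (hu ▸ Finset.subset_union_left)).1
        have : T₂ = ∅ := by
          rw [← hu] at h1
          have h3 : T₂ ⊆ slab j A := by rw [h1]; exact Finset.subset_union_right
          exact Finset.subset_empty.1 (hd h3 le_rfl)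
        rw [this, h0] at hb
        exact associated_one_iff_isUnit.1 hb
  have huniv : ∀ i : Fin k, slab i (Finset.univ : Finset (Fin (n i))) = Finset.univ := fun i => by
    ext; simp
  -- The full grid is a slab in each of the `k` directions at once.
  refine ⟨h Finset.univ, fun i => Finset.univ.val.map (fun x => h (slab i {x})), ?_, ?_, ?_⟩
  · refine fun i => ⟨⟨?_, ?_⟩, by simp⟩
    · intro a ha
      obtain ⟨x, -, rfl⟩ := Multiset.mem_map.1 ha
      exact hirr i x
    · have := hprod i Finset.univ
      rw [huniv] at this
      exact this
  · intro i j hij hsame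
    have hx : h (slab i {⟨0, (hn i).le⟩}) ∈
        (Finset.univ : Finset (Fin (n i))).val.map (fun x => h (slab i {x})) :=
      Multiset.mem_map_of_mem _ (Finset.mem_univ_val _)
    obtain ⟨b, hb, hab⟩ := Multiset.exists_mem_of_rel_of_mem hsame hx
    obtain ⟨y, -, rfl⟩ := Multiset.mem_map.1 hb
    have := hinj _ _ (hS _ _) (hS _ _) hab
    exact hij (slab_subset_singleton hn (Finset.singleton_nonempty _) this.subset).2
  · have key : ∀ s : Multiset R, (∀ a ∈ s, Irreducible a) → ∀ T, IsSlab T → T.Nonempty →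
        Associated s.prod (h T) → ∃ i, ∃ A : Finset (Fin (n i)), T = slab i A ∧
          Multiset.Rel Associated s (A.val.map (fun x => h (slab i {x}))) := by
      intro s
      induction s using Multiset.induction_on with
      | empty =>
        intro _ T hT hne has
        rw [Multiset.prod_zero] at has
        exact absurd (hunit T hT (associated_one_iff_isUnit.1 has.symm)) hne.ne_empty
      | cons a s ih =>
        intro hs T hT hne has
        have ha := hs a (Multiset.mem_cons_self _ _)
        have hs' : ∀ b ∈ s, Irreducible b := fun b hb => hs b (Multiset.mem_cons_of_mem hb)
        obtain ⟨u, hu⟩ := has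
        rw [Multiset.prod_cons, mul_assoc] at hu
        obtain ⟨T₁, T₂, ⟨i, A, rfl⟩, h2, hd, hun, ha1, hb1⟩ := hdiv T hT _ _ hu
        have hb2 : Associated s.prod (h T₂) := (Associated.symm ⟨u, rfl⟩).symm.trans hb1
        obtain ⟨x, rfl⟩ : ∃ x, A = {x} := by
          rcases A.eq_empty_or_nonempty with rfl | ⟨x, hx⟩
          · have : slab i (∅ : Finset (Fin (n i))) = ∅ := by ext; simp
            rw [this, h0] at ha1
            exact absurd (associated_one_iff_isUnit.1 ha1) ha.not_isUnit
          · refine ⟨x, ?_⟩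
            have hir : Irreducible (h (slab i A)) := ha1.irreducible_iff.1 ha
            rw [← hprod, ← Finset.mul_prod_erase _ _ hx, hprod] at hir
            have := hunit _ (hS _ _) (hir.isUnit_or_isUnit rfl |>.resolve_left (hirr i x).not_isUnit)
            have hem : A.erase x = ∅ := by
              by_contra hcon
              exact (slab_nonempty hn (Finset.nonempty_iff_ne_empty.2 hcon)).ne_empty this
            rw [← Finset.insert_erase hx, hem]
            rfl
        rcases T₂.eq_empty_or_nonempty with rfl | hne2
        · refine ⟨i, {x}, by rw [← hun, Finset.union_empty], ?_⟩
          have hs0 : s = 0 := by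
            rw [h0] at hb2
            have hsu := associated_one_iff_isUnit.1 hb2
            by_contra hcon
            obtain ⟨b, hb⟩ := Multiset.exists_mem_of_ne_zero hcon
            exact (hs' b hb).not_isUnit (isUnit_of_dvd_unit (Multiset.dvd_prod hb) hsu)
          subst hs0
          exact Multiset.Rel.cons ha1 Multiset.Rel.zero
        · obtain ⟨j, B, rfl, hrel⟩ := ih hs' T₂ h2 hne2 hb2
          obtain ⟨e, he⟩ := hne2
          rw [mem_slab] at he
          -- Nonempty slabs in different directions meet: set coordinate `i` of a point of one slab
          -- to `x`.
          have hji : j = i := by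
            by_contra hne'
            refine Finset.disjoint_left.1 hd
              (show Function.update e i x ∈ slab i {x} by simp) ?_
            simpa [Function.update_of_ne hne'] using he
          subst hji
          have hxB : x ∉ B := fun hxB =>
            Finset.disjoint_left.1 hd
              (show Function.update e j x ∈ slab j {x} by simp) (by simpa using hxB)
          refine ⟨j, insert x B, ?_, ?_⟩
          · rw [← hun]; ext; simp
          · rw [Finset.insert_val_of_notMem hxB, Multiset.map_cons]
            exact Multiset.Rel.cons ha1 hrel
    intro s hs
    have hi0 : slab (⟨0, hk⟩ : Fin k) (Finset.univ : Finset (Fin (n ⟨0, hk⟩))) = Finset.univ :=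
      huniv _
    have hne : (Finset.univ : Finset (∀ i, Fin (n i))).Nonempty :=
      ⟨fun j => ⟨0, (hn j).le⟩, Finset.mem_univ _⟩
    obtain ⟨i, A, hA, hrel⟩ := key s hs.1 Finset.univ ⟨_, _, hi0.symm⟩ hne (by rw [hs.2])
    refine ⟨i, ?_⟩
    have : A = Finset.univ := by
      refine Finset.eq_univ_of_forall fun x => ?_
      have hm : Function.update (fun j => ⟨0, (hn j).le⟩) i x ∈ slab i A := hA ▸ Finset.mem_univ _
      simpa using hm
    subst this
    exact hrel

end Slab

/-! ### Polynomials with prescribed valuations on residue classes. -/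

section LocalizedPoly

variable {D : Type*} [CommRing D] [IsDomain D]

theorem le_of_prime_pow_mul_eq {p : D} (hp : Prime p) {a b : ℕ} {r s : D} (hs : ¬ p ∣ s)
    (h : p ^ a * r = p ^ b * s) : a ≤ b := by
  by_contra! hlt
  obtain ⟨c, rfl⟩ := Nat.exists_eq_add_of_lt hlt
  refine hs ⟨p ^ c * r, mul_left_cancel₀ (pow_ne_zero b hp.ne_zero) ?_⟩
  rw [← h]; ring

theorem eq_of_prime_pow_mul_eq {p : D} (hp : Prime p) {a b : ℕ} {r s : D} (hr : ¬ p ∣ r)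
    (hs : ¬ p ∣ s) (h : p ^ a * r = p ^ b * s) : a = b :=
  le_antisymm (le_of_prime_pow_mul_eq hp hs h) (le_of_prime_pow_mul_eq hp hr h.symm)

theorem natDegree_C_mul_X_sub_C_pow_add_C {u : D} (hu : u ≠ 0) (c v : D) (n : ℕ) :
    (C u * (X - C c) ^ n + C v).natDegree = n := by
  rw [natDegree_add_C, natDegree_C_mul hu, natDegree_pow, natDegree_X_sub_C, mul_one]

variable [UniqueFactorizationMonoid D] (K : Type*) [Field K] [Algebra D K] [IsFractionRing D K]

/-- Up to a translation and a constant this is `X^n - b` with `b` of `p`-adic valuation `j - i`. As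
this is not a multiple of the prime `n`, `b` is no `n`-th power. -/
theorem irreducible_map_C_mul_X_sub_C_pow_add_C {p : D} (hp : Prime p) {u v : D} {i j n : ℕ}
    (hn : n.Prime) (c : D) (hu : ¬ p ∣ u) (hv : ¬ p ∣ v) (hij : ¬ (n : ℤ) ∣ (i : ℤ) - j) :
    Irreducible ((C (p ^ i * u) * (X - C c) ^ n + C (p ^ j * v)).map (algebraMap D K)) := by
  have hu0 : u ≠ 0 := fun h => hu (h ▸ dvd_zero p)
  have hv0 : v ≠ 0 := fun h => hv (h ▸ dvd_zero p)
  have hU : algebraMap D K (p ^ i * u) ≠ 0 :=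
    (map_ne_zero_iff _ (IsFractionRing.injective D K)).2 (mul_ne_zero (pow_ne_zero _ hp.ne_zero) hu0)
  have hirr : Irreducible (X ^ n - C (-algebraMap D K (p ^ j * v) / algebraMap D K (p ^ i * u))) := by
    refine X_pow_sub_C_irreducible_of_prime hn fun b hb => ?_
    obtain ⟨x, y, hy, rfl⟩ := IsFractionRing.div_surjective (A := D) b
    have hy0 : y ≠ 0 := nonZeroDivisors.ne_zero hy
    have hY : algebraMap D K y ≠ 0 :=
      (map_ne_zero_iff _ (IsFractionRing.injective D K)).2 hy0
    rw [div_pow, div_eq_div_iff (pow_ne_zero _ hY) hU, neg_mul] at hb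
    have hb' : x ^ n * (p ^ i * u) = -(p ^ j * v * y ^ n) := by
      apply IsFractionRing.injective D K
      simpa using hb
    have hx0 : x ≠ 0 := by
      rintro rfl
      rw [zero_pow hn.ne_zero, zero_mul, eq_comm, neg_eq_zero] at hb'
      simp [hp.ne_zero, hv0, hy0] at hb'
    obtain ⟨k, x', hx', rfl⟩ := WfDvdMonoid.max_power_factor hx0 hp.irreducible
    obtain ⟨l, y', hy', rfl⟩ := WfDvdMonoid.max_power_factor hy0 hp.irreducible
    have h1 : ¬ p ∣ x' ^ n * u := fun h =>
      (hp.dvd_or_dvd h).elim (fun h => hx' (hp.dvd_of_dvd_pow h)) hu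
    have h2 : ¬ p ∣ -(v * y' ^ n) := fun h =>
      (hp.dvd_or_dvd ((dvd_neg).1 h)).elim hv (fun h => hy' (hp.dvd_of_dvd_pow h))
    have := eq_of_prime_pow_mul_eq (a := k * n + i) (b := l * n + j) hp h1 h2 (by
      linear_combination hb')
    exact hij ⟨l - k, by push_cast [← @Nat.cast_inj ℤ] at this; linear_combination this⟩
  have heq : (C (p ^ i * u) * (X - C c) ^ n + C (p ^ j * v)).map (algebraMap D K) =
      C (algebraMap D K (p ^ i * u)) * (taylorEquiv (-(algebraMap D K c)))
        (X ^ n - C (-algebraMap D K (p ^ j * v) / algebraMap D K (p ^ i * u))) := by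
    simp only [taylorEquiv, Polynomial.map_add, Polynomial.map_mul, Polynomial.map_pow,
      Polynomial.map_sub, map_X, map_C]
    generalize algebraMap D K (p ^ i * u) = U at *
    generalize algebraMap D K (p ^ j * v) = V at *
    have : C V = C U * C (V / U) := by rw [← C_mul]; congr 1; field_simp
    rw [this]
    simp [sub_eq_add_neg, mul_add, neg_div]
  rw [heq, irreducible_isUnit_mul (isUnit_C.2 hU.isUnit), MulEquiv.irreducible_iff]
  exact hirr

open Classical in
/-- There are polynomials, irreducible over the quotient field, whose values have `p`-adic
valuation `s` on a given residue class modulo `p` and zero on all others, and whose value at zero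
has no prime divisor besides `p`. -/
theorem exists_localized_poly {p : D} (hp : Prime p) [(Ideal.span {p}).IsMaximal]
    (c : D ⧸ Ideal.span {p}) {s n : ℕ} (hn : n.Prime) (hs : s < n) :
    ∃ f : D[X], f.natDegree = n ∧ Irreducible (f.map (algebraMap D K)) ∧ f.eval 0 ∣ p ^ s ∧
      ∀ a, ∃ r, ¬ p ∣ r ∧
        f.eval a = p ^ (if Ideal.Quotient.mk (Ideal.span {p}) a = c then s else 0) * r := by
  have hp1 : ¬ p ∣ 1 := fun h => hp.not_isUnit (isUnit_of_dvd_one h)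
  rcases Nat.eq_zero_or_pos s with rfl | hs0
  -- For `s = 0` the polynomial `p X^n + 1` works: its values are 1 modulo `p`.
  · refine ⟨C (p ^ 1 * 1) * (X - C 0) ^ n + C (p ^ 0 * 1),
      natDegree_C_mul_X_sub_C_pow_add_C (by simpa using hp.ne_zero) _ _ _,
      irreducible_map_C_mul_X_sub_C_pow_add_C K hp hn _ hp1 hp1 ?_, ?_, fun a => ?_⟩
    · intro h
      have h1 : n ∣ 1 := by exact_mod_cast (by simpa using h : (n : ℤ) ∣ 1)
      exact hn.one_lt.ne' (Nat.dvd_one.1 h1)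
    · simp [hn.ne_zero]
    · refine ⟨p * a ^ n + 1, fun h => hp1 ?_, by simp⟩
      exact (dvd_add_right (dvd_mul_right p _)).1 h
  obtain ⟨c₀, u, h, hc₀, hu, hh, hdvd⟩ : ∃ c₀ u h : D, Ideal.Quotient.mk (Ideal.span {p}) c₀ = c ∧
      ¬ p ∣ u ∧ ¬ p ∣ h ∧ u * (-c₀) ^ n + p ^ s * h ∣ p ^ s := by
    by_cases hc : c = 0
    · exact ⟨0, 1, 1, by simp [hc], hp1, hp1, by simp [hn.ne_zero]⟩
    · obtain ⟨c₀, rfl⟩ := Ideal.Quotient.mk_surjective c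
      have hc₀ : c₀ ∉ Ideal.span {p} := fun hmem => hc (Ideal.Quotient.eq_zero_iff_mem.2 hmem)
      obtain ⟨y, i, hi, hyi⟩ := Ideal.IsMaximal.exists_inv ‹(Ideal.span {p}).IsMaximal› hc₀
      obtain ⟨z, rfl⟩ := Ideal.mem_span_singleton.1 hi
      have hcop : IsCoprime c₀ p := ⟨y, z, by rw [mul_comm z]; exact hyi⟩
      -- Multiplying this Bézout relation by `1 - p^s` and adding `p^s` makes the value at zero
      -- equal to 1; the exponent `s + 1` keeps `h` congruent to 1 modulo `p`.
      obtain ⟨α, β, hαβ⟩ := hcop.neg_left.pow (m := n) (n := s + 1)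
      refine ⟨c₀, α * (1 - p ^ s), 1 + p * (β - β * p ^ s), rfl, fun hd => ?_, fun hd => ?_, ?_⟩
      · have hps : p ∣ p ^ s := dvd_pow_self p hs0.ne'
        rcases hp.dvd_or_dvd hd with hd | hd
        · refine hp1 (hαβ ▸ dvd_add (hd.mul_right _) (Dvd.dvd.mul_left ?_ _))
          exact dvd_pow_self p s.succ_ne_zero
        · exact hp1 (by simpa using dvd_add hd hps)
      · exact hp1 ((dvd_add_left (dvd_mul_right p _)).1 hd)
      · have : α * (1 - p ^ s) * (-c₀) ^ n + p ^ s * (1 + p * (β - β * p ^ s)) = 1 := by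
          linear_combination (1 - p ^ s) * hαβ
        rw [this]
        exact one_dvd _
  refine ⟨C (p ^ 0 * u) * (X - C c₀) ^ n + C (p ^ s * h),
      natDegree_C_mul_X_sub_C_pow_add_C (fun h0 => hu (by simp_all)) _ _ _,
      irreducible_map_C_mul_X_sub_C_pow_add_C K hp hn _ hu hh ?_, by simpa using hdvd,
      fun a => ?_⟩
  · intro hd
    have : n ∣ s := by
      have h1 : (n : ℤ) ∣ -(s : ℤ) := by simpa using hd
      exact_mod_cast (dvd_neg.1 h1)
    exact absurd (Nat.le_of_dvd hs0 this) (not_le.2 hs)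
  · have heval : (C (p ^ 0 * u) * (X - C c₀) ^ n + C (p ^ s * h)).eval a =
        u * (a - c₀) ^ n + p ^ s * h := by simp
    have hiff : Ideal.Quotient.mk (Ideal.span {p}) a = c ↔ p ∣ a - c₀ := by
      rw [← hc₀, Ideal.Quotient.eq, Ideal.mem_span_singleton]
    rw [heval]
    split_ifs with hac
    · obtain ⟨z, hz⟩ := hiff.1 hac
      -- Since `s < n`, the power `(a - c₀)^n` is divisible by `p^(s+1)`, so the constant term `p^s
      -- * h` determines the valuation.
      obtain ⟨m, rfl⟩ := Nat.exists_eq_add_of_lt hs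
      refine ⟨p * (u * p ^ m * z ^ (s + m + 1)) + h, fun hd => hh ?_, ?_⟩
      · exact (dvd_add_right (dvd_mul_right p _)).1 hd
      · rw [hz]; ring
    · refine ⟨_, fun hd => ?_, by rw [pow_zero, one_mul]⟩
      have h1 : p ∣ u * (a - c₀) ^ n :=
        (dvd_add_left (Dvd.dvd.mul_right (dvd_pow_self p hs0.ne') _)).1 hd
      exact (hp.dvd_or_dvd h1).elim hu fun h2 => hac (hiff.2 (hp.dvd_of_dvd_pow h2))

end LocalizedPoly

/-! ### Integer-valued quotients and their divisors. -/

section Valuation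

variable {D : Type*} [CommRing D] {K : Type*} [Field K] [Algebra D K]

theorem mem_intPoly {f : K[X]} :
    f ∈ IntPoly D K ↔ ∀ a : D, ∃ b : D, algebraMap D K b = f.eval (algebraMap D K a) :=
  Iff.rfl

variable {ι : Type*} {p : D} {f : ι → D[X]} {s : ι → ℕ} {cl : ι → D ⧸ Ideal.span {p}}

open Classical in
/-- The common `p`-adic valuation on the residue class `c` of the values of a product of
polynomials, the `j`-th of which has valuation `s j` on the class `cl j` and zero elsewhere. -/
noncomputable def classVal {p : D} (s : ι → ℕ) (cl : ι → D ⧸ Ideal.span {p}) (t : Finset ι)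
    (c : D ⧸ Ideal.span {p}) : ℕ :=
  ∑ j ∈ t, if c = cl j then s j else 0

theorem classVal_union [DecidableEq ι] {t u : Finset ι} (h : Disjoint t u)
    (c : D ⧸ Ideal.span {p}) :
    classVal s cl (t ∪ u) c = classVal s cl t c + classVal s cl u c :=
  Finset.sum_union h

open Classical in
theorem eval_prod_localized (hp : Prime p)
    (hf : ∀ j a, ∃ r, ¬ p ∣ r ∧
      (f j).eval a = p ^ (if Ideal.Quotient.mk (Ideal.span {p}) a = cl j then s j else 0) * r)
    (t : Finset ι) (a : D) :
    ∃ r, ¬ p ∣ r ∧ (∏ j ∈ t, f j).eval a = p ^ classVal s cl t (Ideal.Quotient.mk _ a) * r := by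
  choose r hr hfr using hf
  refine ⟨∏ j ∈ t, r j a, fun hd => ?_, ?_⟩
  · obtain ⟨j, -, hj⟩ := (hp.dvd_finsetProd_iff _).1 hd
    exact hr j a hj
  · rw [eval_prod, Finset.prod_congr rfl fun j _ => hfr j a, Finset.prod_mul_distrib,
      Finset.prod_pow_eq_pow_sum]
    rfl

variable [IsFractionRing D K]

theorem mem_intPoly_of_le (hp : Prime p) {g : D[X]} {m : ℕ} (h : ∀ a, p ^ m ∣ g.eval a) :
    C (algebraMap D K p ^ m)⁻¹ * g.map (algebraMap D K) ∈ IntPoly D K := by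
  rw [mem_intPoly]
  intro a
  obtain ⟨b, hb⟩ := h a
  have hpK : algebraMap D K p ≠ 0 :=
    (map_ne_zero_iff _ (IsFractionRing.injective D K)).2 hp.ne_zero
  refine ⟨b, ?_⟩
  rw [eval_mul, eval_C, eval_map_algebraMap, aeval_algebraMap_apply, coe_aeval_eq_eval, hb, map_mul,
    map_pow, inv_mul_cancel_left₀ (pow_ne_zero _ hpK)]

/-- A leading constant of an integer-valued multiple of a product of localized polynomials has
denominator a bounded power of `p`. -/
theorem exists_pow_mul_eq_of_mem_intPoly (hp : Prime p) {g : D[X]} {N : ℕ} {v : D → ℕ}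
    (h0 : g.eval 0 ∣ p ^ N) (hg : ∀ a, ∃ r, ¬ p ∣ r ∧ g.eval a = p ^ v a * r) {y : K}
    (hy : C y * g.map (algebraMap D K) ∈ IntPoly D K) :
    ∃ (d : D) (m : ℕ), y * algebraMap D K p ^ m = algebraMap D K d ∧ ∀ a, m ≤ v a := by
  classical
  have hy' : ∀ a, ∃ b : D, algebraMap D K b = y * algebraMap D K (g.eval a) := fun a => by
    obtain ⟨b, hb⟩ := mem_intPoly.1 hy a
    refine ⟨b, ?_⟩
    rw [hb, eval_mul, eval_C, eval_map_algebraMap, aeval_algebraMap_apply, coe_aeval_eq_eval]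
  -- The value at zero divides a power of `p`, which keeps all other primes out of the denominator
  -- of `y`.
  have hex : ∃ m : ℕ, ∃ d : D, y * algebraMap D K p ^ m = algebraMap D K d := by
    obtain ⟨b, hb⟩ := hy' 0
    obtain ⟨z, hz⟩ := h0
    exact ⟨N, b * z, by rw [← map_pow, hz, map_mul, map_mul, hb, mul_assoc]⟩
  obtain ⟨d, hd⟩ := Nat.find_spec hex
  refine ⟨d, Nat.find hex, hd, fun a => ?_⟩
  by_contra! hlt
  obtain ⟨r, hr, har⟩ := hg a
  obtain ⟨b, hb⟩ := hy' a
  obtain ⟨q, hq⟩ := Nat.exists_eq_add_of_lt hlt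
  -- Otherwise a smaller exponent would clear the denominator.
  have hpd : ¬ p ∣ d := by
    rintro ⟨d', rfl⟩
    refine Nat.find_min hex (m := v a + q) (by lia) ⟨d', ?_⟩
    have hpK : algebraMap D K p ≠ 0 :=
      (map_ne_zero_iff _ (IsFractionRing.injective D K)).2 hp.ne_zero
    apply mul_left_cancel₀ hpK
    rw [← map_mul, ← hd, hq]; ring
  have : d * r = p ^ (q + 1) * b := by
    apply IsFractionRing.injective D K
    rw [map_mul, map_mul, hb, ← hd, hq, har]
    simp only [map_mul, map_pow]
    ring
  have hdr : p ∣ d * r := this ▸ Dvd.dvd.mul_right (dvd_pow_self p q.succ_ne_zero) b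
  exact (hp.dvd_or_dvd hdr).elim hpd hr

open Classical in
/-- Divisors in `Int(D)` of a balanced product of localized polynomials are again balanced. -/
theorem exists_balanced_of_mul_eq (hp : Prime p)
    (hirr : ∀ j, Irreducible ((f j).map (algebraMap D K))) (hf0 : ∀ j, (f j).eval 0 ∣ p ^ s j)
    (hf : ∀ j a, ∃ r, ¬ p ∣ r ∧
      (f j).eval a = p ^ (if Ideal.Quotient.mk (Ideal.span {p}) a = cl j then s j else 0) * r)
    {J : Finset ι} {S : ℕ} (hS : ∀ c, classVal s cl J c = S) {a b : K[X]}
    (ha : a ∈ IntPoly D K) (hb : b ∈ IntPoly D K)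
    (hab : a * b = C (algebraMap D K p ^ S)⁻¹ * ∏ j ∈ J, (f j).map (algebraMap D K)) :
    ∃ (t u : Finset ι) (m m' : ℕ) (d d' : Dˣ), t ∪ u = J ∧ Disjoint t u ∧
      (∀ c, classVal s cl t c = m) ∧ (∀ c, classVal s cl u c = m') ∧
      a = C (algebraMap D K d) *
        (C (algebraMap D K p ^ m)⁻¹ * ∏ j ∈ t, (f j).map (algebraMap D K)) ∧
      b = C (algebraMap D K d') *
        (C (algebraMap D K p ^ m')⁻¹ * ∏ j ∈ u, (f j).map (algebraMap D K)) := by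
  have hpK : algebraMap D K p ≠ 0 :=
    (map_ne_zero_iff _ (IsFractionRing.injective D K)).2 hp.ne_zero
  obtain ⟨t, u, b', c', htu, hd, hbc, rfl, rfl⟩ :=
    mul_eq_mul_prime_prod (fun j _ => (hirr j).prime) hab
  have hu : IsUnit (b' * c') := by
    rw [← hbc]; exact isUnit_C.2 (inv_ne_zero (pow_ne_zero _ hpK)).isUnit
  obtain ⟨y, -, rfl⟩ := Polynomial.isUnit_iff.1 (isUnit_of_mul_isUnit_left hu)
  obtain ⟨y', -, rfl⟩ := Polynomial.isUnit_iff.1 (isUnit_of_mul_isUnit_right hu)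
  rw [← C_mul, C_inj] at hbc
  have h0 : ∀ t : Finset ι, (∏ j ∈ t, f j).eval 0 ∣ p ^ ∑ j ∈ t, s j := fun t => by
    rw [eval_prod, ← Finset.prod_pow_eq_pow_sum]
    exact Finset.prod_dvd_prod_of_dvd _ _ fun j _ => hf0 j
  rw [← Polynomial.map_prod] at ha hb
  obtain ⟨d, m, hdm, hm⟩ :=
    exists_pow_mul_eq_of_mem_intPoly hp (h0 t) (eval_prod_localized hp hf t) ha
  obtain ⟨d', m', hdm', hm'⟩ :=
    exists_pow_mul_eq_of_mem_intPoly hp (h0 u) (eval_prod_localized hp hf u) hb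
  have hsum : ∀ c, classVal s cl t c + classVal s cl u c = S := fun c => by
    rw [← classVal_union hd, htu, hS]
  have hmc : ∀ c, m ≤ classVal s cl t c := fun c => by
    obtain ⟨x, rfl⟩ := Ideal.Quotient.mk_surjective c; exact hm x
  have hmc' : ∀ c, m' ≤ classVal s cl u c := fun c => by
    obtain ⟨x, rfl⟩ := Ideal.Quotient.mk_surjective c; exact hm' x
  obtain ⟨q, hq⟩ : ∃ q, S = m + m' + q :=
    Nat.exists_eq_add_of_le ((add_le_add (hmc 0) (hmc' 0)).trans_eq (hsum 0))
  -- The constants of `a` and `b` multiply to `p^(-S)`. This makes `d`, `d'` units and leaves no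
  -- slack `q`, so the bounds `hmc` and `hmc'` are equalities.
  have hprod : d * d' * p ^ q = 1 := by
    apply IsFractionRing.injective D K
    rw [map_mul, map_mul, ← hdm, ← hdm', map_pow, map_one]
    have : y * y' * algebraMap D K p ^ S = 1 := by
      rw [← hbc, inv_mul_cancel₀ (pow_ne_zero _ hpK)]
    rw [← this, hq]; ring
  have hq0 : q = 0 := by
    by_contra hq0
    exact hp.not_isUnit ((isUnit_pow_iff hq0).1
      (isUnit_of_mul_isUnit_right (hprod ▸ isUnit_one : IsUnit (d * d' * p ^ q))))
  subst hq0
  rw [pow_zero, mul_one] at hprod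
  have hval : ∀ c, classVal s cl t c = m ∧ classVal s cl u c = m' := fun c => by
    have h1 := hsum c; have h2 := hmc c; have h3 := hmc' c
    lia
  refine ⟨t, u, m, m', Units.mkOfMulEqOne _ _ hprod,
    Units.mkOfMulEqOne _ _ ((mul_comm _ _).trans hprod), htu, hd, fun c => (hval c).1,
    fun c => (hval c).2, ?_, ?_⟩
  · rw [← mul_assoc, ← C_mul, Units.val_mkOfMulEqOne, ← hdm,
      mul_inv_cancel_right₀ (pow_ne_zero _ hpK)]
  · rw [← mul_assoc, ← C_mul, Units.val_mkOfMulEqOne, ← hdm',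
      mul_inv_cancel_right₀ (pow_ne_zero _ hpK)]

end Valuation

/-! ### Balancing weighted families with auxiliary polynomials. -/

section Weighted

variable {D : Type*} [CommRing D] {p : D} {E : Type*}

/-- The residue classes modulo `p` other than those of zero and one. -/
abbrev OtherClass (p : D) : Type _ := {c : D ⧸ Ideal.span {p} // c ≠ 0 ∧ c ≠ 1}

/-- Valuations prescribed by a weight: its absolute value, and one for the auxiliary classes. -/
def weightVal (p : D) (w : E → ℤ) : E ⊕ OtherClass p → ℕ :=
  Sum.elim (fun e => (w e).natAbs) (fun _ => 1)

/-- Residue classes prescribed by a weight, according to its sign. -/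
noncomputable def weightClass (p : D) (w : E → ℤ) : E ⊕ OtherClass p → D ⧸ Ideal.span {p} :=
  Sum.elim (fun e => if 0 ≤ w e then 0 else 1) Subtype.val

/-- Forget the multiplicity index of an auxiliary class. -/
def forgetIndex {E C : Type*} : E ⊕ (C × ℕ) → E ⊕ C := Sum.map id Prod.fst

theorem classVal_weight (w : E → ℤ) (t : Finset (E ⊕ (OtherClass p × ℕ)))
    (c : D ⧸ Ideal.span {p}) :
    classVal (weightVal p w ∘ forgetIndex) (weightClass p w ∘ forgetIndex) t c =
      classVal (fun e => (w e).natAbs) (fun e => if 0 ≤ w e then 0 else 1) t.toLeft c +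
      classVal (fun _ => 1) (fun x : OtherClass p × ℕ => (x.1 : D ⧸ Ideal.span {p})) t.toRight c := by
  conv_lhs => rw [← Finset.toLeft_disjSum_toRight (u := t)]
  unfold classVal
  rw [Finset.sum_disjSum]
  rfl

theorem classVal_weight_zero [(Ideal.span {p}).IsMaximal] (w : E → ℤ)
    (t : Finset (E ⊕ (OtherClass p × ℕ))) :
    classVal (weightVal p w ∘ forgetIndex) (weightClass p w ∘ forgetIndex) t 0 =
      ∑ e ∈ t.toLeft, (w e).toNat := by
  have := Ideal.Quotient.nontrivial_iff.2 (Ideal.IsMaximal.ne_top ‹(Ideal.span {p}).IsMaximal›)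
  rw [classVal_weight]
  unfold classVal
  rw [Finset.sum_eq_zero (s := t.toRight) fun x _ => if_neg x.1.2.1.symm, add_zero]
  refine Finset.sum_congr rfl fun e _ => ?_
  by_cases h : 0 ≤ w e
  · simp only [h, if_true]; lia
  · simp only [h, if_false, zero_ne_one]; lia

theorem classVal_weight_one [(Ideal.span {p}).IsMaximal] (w : E → ℤ)
    (t : Finset (E ⊕ (OtherClass p × ℕ))) :
    classVal (weightVal p w ∘ forgetIndex) (weightClass p w ∘ forgetIndex) t 1 =
      ∑ e ∈ t.toLeft, (-w e).toNat := by
  have := Ideal.Quotient.nontrivial_iff.2 (Ideal.IsMaximal.ne_top ‹(Ideal.span {p}).IsMaximal›)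
  rw [classVal_weight]
  unfold classVal
  rw [Finset.sum_eq_zero (s := t.toRight) fun x _ => if_neg x.1.2.2.symm, add_zero]
  refine Finset.sum_congr rfl fun e _ => ?_
  by_cases h : 0 ≤ w e
  · simp only [h, if_true, one_ne_zero, if_false]; lia
  · simp only [h, if_false, if_true]; lia

open Classical in
theorem classVal_weight_other (w : E → ℤ) (t : Finset (E ⊕ (OtherClass p × ℕ)))
    (c : OtherClass p) :
    classVal (weightVal p w ∘ forgetIndex) (weightClass p w ∘ forgetIndex) t c =
      (t.toRight.filter (fun x => x.1 = c)).card := by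
  rw [classVal_weight]
  unfold classVal
  rw [Finset.sum_eq_zero (s := t.toLeft), zero_add, Finset.card_filter]
  · exact Finset.sum_congr rfl fun x _ => if_congr (by rw [eq_comm, Subtype.coe_inj]) rfl rfl
  · intro e _
    rw [if_neg]
    dsimp only
    split_ifs
    exacts [c.2.1, c.2.2]

theorem sum_weight_eq_sub (w : E → ℤ) (T : Finset E) :
    ∑ e ∈ T, w e = ((∑ e ∈ T, (w e).toNat : ℕ) : ℤ) - (∑ e ∈ T, (-w e).toNat : ℕ) := by
  push_cast
  rw [← Finset.sum_sub_distrib]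
  exact Finset.sum_congr rfl fun e _ => by lia

/-- A set of polynomials together with the auxiliary ones that balance it. -/
noncomputable def weightIndex [Finite (D ⧸ Ideal.span {p})] (w : E → ℤ) (T : Finset E) :
    Finset (E ⊕ (OtherClass p × ℕ)) :=
  letI := Fintype.ofFinite (OtherClass p)
  T.disjSum (Finset.univ ×ˢ Finset.range (∑ e ∈ T, (w e).toNat))

@[simp]
theorem toLeft_weightIndex [Finite (D ⧸ Ideal.span {p})] (w : E → ℤ) (T : Finset E) :
    (weightIndex (p := p) w T).toLeft = T :=
  Finset.toLeft_disjSum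

theorem classVal_weightIndex [(Ideal.span {p}).IsMaximal] [Finite (D ⧸ Ideal.span {p})]
    {w : E → ℤ} {T : Finset E} (hT : ∑ e ∈ T, w e = 0) (c : D ⧸ Ideal.span {p}) :
    classVal (weightVal p w ∘ forgetIndex) (weightClass p w ∘ forgetIndex)
      (weightIndex (p := p) w T) c = ∑ e ∈ T, (w e).toNat := by
  classical
  by_cases h0 : c = 0
  · rw [h0, classVal_weight_zero, toLeft_weightIndex]
  by_cases h1 : c = 1
  · rw [h1, classVal_weight_one, toLeft_weightIndex]
    rw [sum_weight_eq_sub] at hT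
    lia
  let := Fintype.ofFinite (OtherClass p)
  rw [show c = ((⟨c, h0, h1⟩ : OtherClass p) : D ⧸ Ideal.span {p}) from rfl,
    classVal_weight_other]
  have : (weightIndex (p := p) w T).toRight.filter (fun x => x.1 = ⟨c, h0, h1⟩) =
      ({⟨c, h0, h1⟩} : Finset (OtherClass p)) ×ˢ Finset.range (∑ e ∈ T, (w e).toNat) := by
    ext ⟨x, i⟩
    simp [weightIndex, and_comm, eq_comm (a := x)]
  rw [this]
  simp

variable {K : Type*} [Field K] [Algebra D K]

open Classical in
/-- The factor belonging to `e` of the products of integer-valued polynomials under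
consideration. -/
noncomputable def weightFactor [Finite (D ⧸ Ideal.span {p})] (w : E → ℤ)
    (F : E ⊕ OtherClass p → K[X]) (e : E) : K[X] :=
  letI := Fintype.ofFinite (OtherClass p)
  C (algebraMap D K p ^ (w e).toNat)⁻¹ * F (Sum.inl e) * (∏ c, F (Sum.inr c)) ^ (w e).toNat

/-- Balance on the classes 0 and 1 gives weight zero; on each other class it forces exactly `m`
auxiliary factors. As `m` is the sum of the positive parts of the weights, both the auxiliary
factors and `p^m` can be distributed over the `e`, making the product multiplicative in the subset
of `E`. -/
theorem balanced_prod_eq [(Ideal.span {p}).IsMaximal] [Finite (D ⧸ Ideal.span {p})]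
    (w : E → ℤ) (F : E ⊕ OtherClass p → K[X]) {t : Finset (E ⊕ (OtherClass p × ℕ))} {m : ℕ}
    (ht : ∀ c, classVal (weightVal p w ∘ forgetIndex) (weightClass p w ∘ forgetIndex) t c = m) :
    ∑ e ∈ t.toLeft, w e = 0 ∧
      C (algebraMap D K p ^ m)⁻¹ * ∏ j ∈ t, F (forgetIndex j) =
        ∏ e ∈ t.toLeft, weightFactor w F e := by
  classical
  have h0 := ht 0
  have h1 := ht 1
  rw [classVal_weight_zero] at h0
  rw [classVal_weight_one] at h1
  refine ⟨by rw [sum_weight_eq_sub, h0, h1, sub_self], ?_⟩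
  let := Fintype.ofFinite (OtherClass p)
  have hleft : ∏ e ∈ t.toLeft, weightFactor w F e =
      C (algebraMap D K p ^ m)⁻¹ * (∏ e ∈ t.toLeft, F (Sum.inl e)) *
        (∏ c, F (Sum.inr c)) ^ m := by
    unfold weightFactor
    rw [Finset.prod_mul_distrib, Finset.prod_mul_distrib, Finset.prod_pow_eq_pow_sum, h0,
      ← map_prod, Finset.prod_inv_distrib, Finset.prod_pow_eq_pow_sum, h0]
  have hright : ∏ x ∈ t.toRight, F (Sum.inr x.1) = (∏ c, F (Sum.inr c)) ^ m := by
    rw [← Finset.prod_fiberwise t.toRight Prod.fst, ← Finset.prod_pow]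
    refine Finset.prod_congr rfl fun c _ => ?_
    rw [Finset.prod_congr rfl (g := fun _ => F (Sum.inr c)) fun x hx => by
      rw [(Finset.mem_filter.1 hx).2], Finset.prod_const, ← ht c, classVal_weight_other]
  rw [hleft, ← hright, mul_assoc]
  conv_lhs => rw [← Finset.toLeft_disjSum_toRight (u := t), Finset.prod_disjSum]
  rfl

end Weighted

/-! ### Construction of elements with prescribed factorizations. -/

section Construction

variable {D : Type*} [CommRing D] [IsDomain D] [UniqueFactorizationMonoid D]
  (K : Type*) [Field K] [Algebra D K] [IsFractionRing D K]

-- Taking distinct primes as degrees makes the polynomials pairwise non-associated over `K`, so a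
-- product reveals its index set.
open Classical in
theorem exists_weight_polys {p : D} (hp : Prime p) [(Ideal.span {p}).IsMaximal]
    {ι : Type*} [Finite ι] (s : ι → ℕ) (cl : ι → D ⧸ Ideal.span {p}) :
    ∃ f : ι → D[X], Function.Injective (fun j => (f j).natDegree) ∧
      (∀ j, Irreducible ((f j).map (algebraMap D K))) ∧ (∀ j, (f j).eval 0 ∣ p ^ s j) ∧
      ∀ j a, ∃ r, ¬ p ∣ r ∧
        (f j).eval a = p ^ (if Ideal.Quotient.mk (Ideal.span {p}) a = cl j then s j else 0) * r := by
  obtain ⟨N, ⟨g⟩⟩ := Finite.exists_equiv_fin ι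
  obtain ⟨B, hB⟩ := Set.finite_range s |>.bddAbove
  -- The prime with index `B + 1 + g j` is at least that index, hence exceeds `s j`.
  let ν : ι → ℕ := fun j => Nat.nth Nat.Prime (B + 1 + g j)
  have hmono := Nat.nth_strictMono Nat.infinite_setOfPred_prime
  have hν : ∀ j, s j < ν j := fun j => by
    have h1 : s j ≤ B := hB ⟨j, rfl⟩
    have h2 : B + 1 + g j ≤ ν j := hmono.le_apply
    lia
  choose f hdeg hirr h0 hf using fun j =>
    exists_localized_poly K hp (cl j) (Nat.nth_mem_of_infinite Nat.infinite_setOfPred_prime _) (hν j)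
  refine ⟨f, fun i j hij => ?_, hirr, h0, hf⟩
  simp only [hdeg] at hij
  exact g.injective (Fin.ext (by simpa using hmono.injective hij))

/-- Integer-valued polynomials indexed by the finite sets of total weight zero, whose divisors
correspond to the subsets of total weight zero. -/
theorem exists_intPoly_of_weight {p : D} (hp : Prime p) [(Ideal.span {p}).IsMaximal]
    [Finite (D ⧸ Ideal.span {p})] {E : Type*} [Finite E] [DecidableEq E] (w : E → ℤ) :
    ∃ h : Finset E → IntPoly D K, h ∅ = 1 ∧
      (∀ T T', ∑ e ∈ T, w e = 0 → ∑ e ∈ T', w e = 0 → Disjoint T T' →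
        h (T ∪ T') = h T * h T') ∧
      (∀ T, ∑ e ∈ T, w e = 0 → ∀ a b, a * b = h T → ∃ T₁ T₂, ∑ e ∈ T₁, w e = 0 ∧
        ∑ e ∈ T₂, w e = 0 ∧ Disjoint T₁ T₂ ∧ T₁ ∪ T₂ = T ∧
        Associated a (h T₁) ∧ Associated b (h T₂)) ∧
      (∀ T T', ∑ e ∈ T, w e = 0 → ∑ e ∈ T', w e = 0 → Associated (h T) (h T') → T = T') := by
  classical
  obtain ⟨f, hdeg, hirr, hf0, hf⟩ := exists_weight_polys K hp (weightVal p w) (weightClass p w)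
  let F : E ⊕ OtherClass p → K[X] := fun j => (f j).map (algebraMap D K)
  have hbal : ∀ t m, (∀ c, classVal (weightVal p w ∘ forgetIndex)
      (weightClass p w ∘ forgetIndex) t c = m) → _ := fun t m => balanced_prod_eq w F
  have hmem : ∀ T, ∑ e ∈ T, w e = 0 → ∏ e ∈ T, weightFactor w F e ∈ IntPoly D K := by
    intro T hT
    have := (hbal _ _ (classVal_weightIndex (p := p) hT)).2
    rw [toLeft_weightIndex] at this
    rw [← this]
    simp only [F]
    rw [← Polynomial.map_prod (algebraMap D K) (fun j => f (forgetIndex j))]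
    refine mem_intPoly_of_le hp fun a => ?_
    obtain ⟨r, -, hr⟩ := eval_prod_localized (f := f ∘ forgetIndex) hp (fun j a => hf _ a)
      (weightIndex (p := p) w T) a
    exact ⟨r, by rw [← classVal_weightIndex (p := p) hT]; exact hr⟩
  let h : Finset E → IntPoly D K := fun T =>
    if hT : ∑ e ∈ T, w e = 0 then ⟨_, hmem T hT⟩ else 1
  have hcoe : ∀ T, ∑ e ∈ T, w e = 0 → (h T : K[X]) = ∏ e ∈ T, weightFactor w F e :=
    fun T hT => by simp only [h, dif_pos hT]
  have hassoc : ∀ T, ∑ e ∈ T, w e = 0 → ∀ (a : IntPoly D K) (d : Dˣ),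
      (a : K[X]) = C (algebraMap D K d) * ∏ e ∈ T, weightFactor w F e → Associated a (h T) := by
    intro T hT a d had
    refine Associated.symm ⟨d.map (algebraMap D (IntPoly D K)).toMonoidHom, Subtype.ext ?_⟩
    rw [had, ← hcoe T hT, mul_comm]
    rfl
  have hinj : ∀ T T', ∑ e ∈ T, w e = 0 → ∑ e ∈ T', w e = 0 → Associated (h T) (h T') →
      T ⊆ T' := by
    intro T T' hT hT' hass e he
    have hdvd : (h T : K[X]) ∣ h T' := map_dvd (IntPoly D K).subtype hass.dvd
    rw [hcoe T hT, hcoe T' hT'] at hdvd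
    have hFe : F (Sum.inl e) ∣ ∏ e ∈ T, weightFactor w F e :=
      ((Dvd.intro_left _ rfl).mul_right _).trans (Finset.dvd_prod_of_mem _ he)
    have hprime := (hirr (Sum.inl e)).prime
    -- Divisibility between irreducibles forces equal degrees, and the degrees are distinct.
    have hne : ∀ j, F (Sum.inl e) ∣ F j → Sum.inl e = j := fun j hj => by
      refine hdeg ?_
      have := natDegree_eq_of_degree_eq
        (degree_eq_degree_of_associated ((hirr (Sum.inl e)).associated_of_dvd (hirr j) hj))
      simpa [natDegree_map_eq_of_injective (IsFractionRing.injective D K)] using this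
    obtain ⟨e', he', hee'⟩ := (hprime.dvd_finsetProd_iff _).1 (hFe.trans hdvd)
    rcases hprime.dvd_or_dvd hee' with h1 | h1
    · rcases hprime.dvd_or_dvd h1 with h2 | h2
      · have hpK : algebraMap D K p ≠ 0 :=
          (map_ne_zero_iff _ (IsFractionRing.injective D K)).2 hp.ne_zero
        exact absurd (isUnit_of_dvd_unit h2 (isUnit_C.2 (inv_ne_zero (pow_ne_zero _ hpK)).isUnit))
          hprime.not_isUnit
      · rw [Sum.inl_injective (hne _ h2)]
        exact he'
    · obtain ⟨c, -, hc⟩ := (hprime.dvd_finsetProd_iff _).1 (hprime.dvd_of_dvd_pow h1)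
      exact absurd (hne _ hc) Sum.inl_ne_inr
  refine ⟨h, Subtype.ext (by rw [hcoe ∅ (by simp)]; simp), ?_, ?_, ?_⟩
  · intro T T' hT hT' hd
    have hTT' : ∑ e ∈ T ∪ T', w e = 0 := by rw [Finset.sum_union hd, hT, hT', add_zero]
    refine Subtype.ext ?_
    rw [MulMemClass.coe_mul, hcoe _ hTT', hcoe _ hT, hcoe _ hT', Finset.prod_union hd]
  · intro T hT a b hab
    have hval := classVal_weightIndex (p := p) hT
    have hab' : (a : K[X]) * b = _ := congrArg Subtype.val hab
    have hprod := (hbal _ _ hval).2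
    rw [toLeft_weightIndex] at hprod
    rw [hcoe T hT, ← hprod] at hab'
    obtain ⟨t, u, m, m', d, d', htu, hd, ht, hu, ha, hb⟩ :=
      exists_balanced_of_mul_eq (f := f ∘ forgetIndex) hp (fun j => hirr _) (fun j => hf0 _)
        (fun j a => hf _ a) hval a.2 b.2 hab'
    obtain ⟨ht0, htp⟩ := hbal t m ht
    obtain ⟨hu0, hup⟩ := hbal u m' hu
    refine ⟨t.toLeft, u.toLeft, ht0, hu0, ?_, ?_, hassoc _ ht0 a d ?_, hassoc _ hu0 b d' ?_⟩
    · exact Finset.disjoint_left.2 fun e he he' =>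
        Finset.disjoint_left.1 hd (Finset.mem_toLeft.1 he) (Finset.mem_toLeft.1 he')
    · rw [← toLeft_weightIndex (p := p) w T, ← htu]
      ext e; simp
    · rw [← htp]; exact ha
    · rw [← hup]; exact hb
  · exact fun T T' hT hT' hass =>
      Finset.Subset.antisymm (hinj T T' hT hT' hass) (hinj T' T hT' hT hass.symm)

theorem hasFullSystem_of_finite_quotient {p : D} (hp : Prime p) [(Ideal.span {p}).IsMaximal]
    [Finite (D ⧸ Ideal.span {p})] : HasFullSystemOfMultisetsOfLengths (IntPoly D K) := by
  intro k n hk hn _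
  obtain ⟨w, hw⟩ := exists_weight (n := n) hk
  obtain ⟨h, h0, hmul, hdiv, hinj⟩ := exists_intPoly_of_weight K hp w
  simp only [hw] at hmul hdiv hinj
  exact exists_factorizations_of_slab hk hn h h0 hmul hdiv hinj

end Construction

/-! ### The case of unique factorization. -/

section UniqueFactorization

theorem not_hasFullSystem_of_ufm {R : Type*} [CommRing R] [UniqueFactorizationMonoid R] :
    ¬ HasFullSystemOfMultisetsOfLengths R := by
  intro h
  -- Any two prescribed factorizations suffice; lengths 2 and 3 are chosen.
  obtain ⟨H, F, hF, hne, -⟩ := h 2 ![2, 3] (by norm_num) (by intro i; fin_cases i <;> simp)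
    (by intro i j hij; fin_cases i <;> fin_cases j <;> simp_all)
  refine hne 0 1 (by simp) (UniqueFactorizationMonoid.factors_unique (hF 0).1.1 (hF 1).1.1 ?_)
  exact Associated.of_eq ((hF 0).1.2.trans (hF 1).1.2.symm)

variable {D K : Type*} [CommRing D] [Field K] [Algebra D K]

theorem mem_polyInFrac {f : K[X]} :
    f ∈ polyInFrac D K ↔ ∃ g : D[X], g.map (algebraMap D K) = f := by
  simp [polyInFrac, mapAlg_eq_map]

theorem polyInFrac_le_intPoly : polyInFrac D K ≤ IntPoly D K := by
  intro f hf
  obtain ⟨g, rfl⟩ := mem_polyInFrac.1 hf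
  exact fun a => ⟨g.eval a, by
    rw [eval_map_algebraMap, aeval_algebraMap_apply, coe_aeval_eq_eval]⟩

/-- A polynomial all of whose values are divisible by a prime with infinite residue ring is itself
divisible by that prime. -/
theorem C_dvd_of_forall_dvd_eval {p : D} (hp : Prime p) [Infinite (D ⧸ Ideal.span {p})]
    {g : D[X]} (hg : ∀ a, p ∣ g.eval a) : C p ∣ g := by
  have : (Ideal.span {p}).IsPrime := (Ideal.span_singleton_prime hp.ne_zero).2 hp
  have h0 : g.map (Ideal.Quotient.mk (Ideal.span {p})) = 0 := by
    refine Polynomial.funext fun x => ?_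
    obtain ⟨a, rfl⟩ := Ideal.Quotient.mk_surjective x
    rw [eval_map, eval₂_at_apply, eval_zero, Ideal.Quotient.eq_zero_iff_mem,
      Ideal.mem_span_singleton]
    exact hg a
  rw [C_dvd_iff_dvd_coeff]
  intro i
  rw [← Ideal.mem_span_singleton, ← Ideal.Quotient.eq_zero_iff_mem, ← coeff_map, h0, coeff_zero]

variable [IsFractionRing D K] [UniqueFactorizationMonoid D]

theorem uniqueFactorizationMonoid_polyInFrac :
    UniqueFactorizationMonoid (polyInFrac D K) :=
  (AlgEquiv.ofInjective (mapAlg D K) (by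
    intro f g hfg
    rw [mapAlg_eq_map, mapAlg_eq_map] at hfg
    exact map_injective _ (IsFractionRing.injective D K) hfg)).toMulEquiv.uniqueFactorizationMonoid
      inferInstance

variable [IsDomain D]

theorem intPoly_eq_polyInFrac
    (h : ∀ p : D, Prime p → Infinite (D ⧸ Ideal.span {p})) : IntPoly D K = polyInFrac D K := by
  refine le_antisymm (fun f hf => ?_) polyInFrac_le_intPoly
  -- Induction on the prime factors of a common denominator `d`, cancelling one at a time.
  have key : ∀ d : D, d ≠ 0 → ∀ f ∈ IntPoly D K, C (algebraMap D K d) * f ∈ polyInFrac D K →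
      f ∈ polyInFrac D K := by
    intro d
    induction d using UniqueFactorizationMonoid.induction_on_prime with
    | h₁ => exact fun h => absurd rfl h
    | h₂ d hd =>
      intro _ f _ hdf
      obtain ⟨u, rfl⟩ := hd
      have := (polyInFrac D K).smul_mem hdf ((u⁻¹ : Dˣ) : D)
      rwa [Algebra.smul_def, Polynomial.algebraMap_apply, ← mul_assoc, ← C_mul, ← map_mul,
        Units.inv_mul, map_one, C_1, one_mul] at this
    | h₃ d p hd hp ih =>
      intro _ f hf hdf
      have := h p hp
      refine ih hd f hf ?_
      obtain ⟨g, hg⟩ := mem_polyInFrac.1 hdf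
      have hdvd : ∀ a, p ∣ g.eval a := by
        intro a
        obtain ⟨b, hb⟩ := hf a
        refine ⟨d * b, IsFractionRing.injective D K ?_⟩
        have hb' : algebraMap D K b = f.eval (algebraMap D K a) := hb
        rw [← coe_aeval_eq_eval, ← aeval_algebraMap_apply, ← eval_map_algebraMap, hg]
        simp [hb', mul_assoc]
      obtain ⟨g', rfl⟩ := C_dvd_of_forall_dvd_eval hp hdvd
      refine mem_polyInFrac.2 ⟨g', ?_⟩
      have hpK : C (algebraMap D K p) ≠ 0 :=
        C_ne_zero.2 ((map_ne_zero_iff _ (IsFractionRing.injective D K)).2 hp.ne_zero)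
      apply mul_left_cancel₀ hpK
      rw [← mul_assoc, ← C_mul, ← map_mul, ← hg, Polynomial.map_mul, map_C]
  obtain ⟨b, hb, hbf⟩ := IsLocalization.integerNormalization_spec (nonZeroDivisors D) f
  refine key b (nonZeroDivisors.ne_zero hb) f hf (mem_polyInFrac.2 ⟨_, hbf.trans ?_⟩)
  rw [Algebra.smul_def, Polynomial.algebraMap_apply]

/-- A nonzero prime ideal inside `(p)` contains a prime element, which must be associated to `p`. -/
theorem height_span_singleton_of_prime {p : D} (hp : Prime p) : (Ideal.span {p}).height = 1 := by
  have hP : (Ideal.span {p}).IsPrime := (Ideal.span_singleton_prime hp.ne_zero).2 hp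
  refine le_antisymm ?_ ?_
  · rw [← Nat.cast_one, Ideal.height_le_iff]
    intro q hq hlt
    have : q = ⊥ := by
      by_contra hne
      obtain ⟨r, hr, hrp⟩ := hq.exists_mem_prime_of_ne_bot hne
      have hass : Associated p r :=
        (hp.irreducible.dvd_irreducible_iff_associated hrp.irreducible).1
          (Ideal.mem_span_singleton.1 (hlt.le hr))
      exact hlt.not_ge ((Ideal.span_singleton_le_iff_mem _).2
        ((q.mem_of_dvd hass.symm.dvd hr)))
    simp [this]
  · rw [Order.one_le_iff_ne_zero, Ne, Ideal.height_eq_zero_iff_eq_bot, Ideal.span_singleton_eq_bot]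
    exact hp.ne_zero

end UniqueFactorization

theorem mainTheorem2 {D K : Type*} [CommRing D] [IsDomain D] [UniqueFactorizationMonoid D]
    [Field K] [Algebra D K] [IsFractionRing D K] :
    Xor (IntPoly D K = polyInFrac D K ∧ UniqueFactorizationMonoid (IntPoly D K))
      (HasFullSystemOfMultisetsOfLengths (IntPoly D K)) ∧
    ((IntPoly D K = polyInFrac D K ∧ UniqueFactorizationMonoid (IntPoly D K)) ↔
      ∀ (P : Ideal D) [P.IsPrime], P.height = 1 → Infinite P.ResidueField) := by
  have hUF : UniqueFactorizationMonoid (IntPoly D K) →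
      ¬ HasFullSystemOfMultisetsOfLengths (IntPoly D K) := fun _ => not_hasFullSystem_of_ufm
  by_cases h : ∀ (P : Ideal D) [P.IsPrime], P.height = 1 → Infinite P.ResidueField
  · have heq : IntPoly D K = polyInFrac D K := intPoly_eq_polyInFrac fun p hp => by
      have : (Ideal.span {p}).IsPrime := (Ideal.span_singleton_prime hp.ne_zero).2 hp
      have := h _ (height_span_singleton_of_prime hp)
      by_contra hfin
      have : Finite (D ⧸ Ideal.span {p}) := not_infinite_iff_finite.1 hfin
      exact not_finite (Ideal.span {p}).ResidueField
    have hufm : UniqueFactorizationMonoid (IntPoly D K) :=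
      heq ▸ uniqueFactorizationMonoid_polyInFrac
    exact ⟨Or.inl ⟨⟨heq, hufm⟩, hUF hufm⟩, iff_of_true ⟨heq, hufm⟩ h⟩
  · have hfull : HasFullSystemOfMultisetsOfLengths (IntPoly D K) := by
      push Not at h
      obtain ⟨P, hP, hht, hfin⟩ := h
      obtain ⟨p, hpP, hp⟩ := hP.exists_mem_prime_of_ne_bot (P.ne_bot_of_height_eq_one hht)
      -- Height-one primes of `D` are principal; `D/(p)` embeds in its finite residue field and is
      -- thus a finite domain, hence a field.
      obtain rfl := P.eq_span_singleton_of_height_eq_one hht hpP hp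
      have : Finite (D ⧸ Ideal.span {p}) :=
        Finite.of_injective _ (IsFractionRing.injective (D ⧸ Ideal.span {p})
          (Ideal.span {p}).ResidueField)
      have : (Ideal.span {p}).IsMaximal :=
        Ideal.Quotient.maximal_of_isField _ (Finite.isField_of_domain _)
      exact hasFullSystem_of_finite_quotient K hp
    have hnot : ¬ (IntPoly D K = polyInFrac D K ∧ UniqueFactorizationMonoid (IntPoly D K)) :=
      fun h' => hUF h'.2 hfull
    exact ⟨Or.inr ⟨hfull, hnot⟩, iff_of_false hnot h⟩
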